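/- **Setting.** Let $X\subset\mathbb R^n$, $Y\subset\mathbb R$, $Z=X\times Y$. Fix a norm on $\mathbb R^n$ and a norm on $\mathbb R^n\times\mathbb R$, both written $\|\cdot\|$, with $\|x\|\le\|(x,y)\|$. For $q\ge 1$ put $L_q(z',z'')=\max\{1,\|z'\|,\|z''\|\}^{q-1}$. Let $\mathcal H_k$ be a real reproducing kernel Hilbert space of functions on $X$ with kernel $k$, $k_x=k(\cdot,x)$, and let $\mathcal F\subset\mathcal H_k$ be closed and convex with $0\in\mathcal F$ and $\|f\|_k\le\beta$ for all $f\in\mathcal F$. Let $c:Z\times\mathbb R\to[0,\infty)$ be a cost function. Assume: * (C1) $c(z,\cdot)$ is convex for every $z\in Z$; * (C2) there is a gauge function $\psi:Z\to[0,\infty)$ (continuous, and $\ge 1$ outside a compact set) with $c(z,f(x))\le\psi(z)$ for all $z=(x,y)\in Z$, $f\in\mathcal F$; * (C3)$'$ there is $\Psi:Z\to[0,\infty)$ with $|c(z,w_1)-c(z,w_2)|\le\Psi(z)|w_1-w_2|$ for all $z\in Z$, $w_1,w_2\in Y$; * (C4)$'$ $c(z,\cdot)$ is differentiable for every $z$,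 and there are $C_1>0$, $p_1\ge1$ with $|c_2'(z_1,w_1)-c_2'(z_2,w_2)|\le C_1L_{p_1}(z_1,z_2)(\|z_1-z_2\|+|w_1-w_2|)$ for all $z_1,z_2\in Z$, $w_1,w_2\in\mathbb R$, where $c_2'$ is the derivative in the second argument; moreover $\sup_{z\in Z}L_p(z,z)<\infty$ for an exponent $p\ge p_1+1$; * (K1)$'$ $\|k_{x_1}-k_{x_2}\|_k\le L_k\|x_1-x_2\|$ for all $x_1,x_2\in X$, with a constant $L_k>0$; * $\beta>\sqrt{M_3/\tau}$ for given constants $M_3,\tau>0$. Let $\mathcal M_{Z,M_3}$ be the set of Borel probability measures $P'$ on $Z$ with $\int\psi\,dP'\le M_3$. For a sample $\vec z=(z^1,\dots,z^N)\in Z^N$ with empirical measure $P_N=\frac1N\sum_i\delta_{z^i}$ and for $\lambda_N>0$, let $\hat f(\vec z,\lambda_N)$ be a minimizer over $f\in\mathcal F$ of $\mathbb E_{P_N}[c(z,f(x))]+\lambda_N\|f\|_k^2$. Put $L=C_1\sup_zL_p(z,z)$ and $$C=L(1+\beta L_k)\sup_{x\in X}\|k_x\|_k+L_k\sup_{z\in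 Z,\,f\in\mathcal F}|c_2'(z,f(x))| .$$ **Theorem.** For every $N\ge1$ and $\lambda_N\ge\tau$: 1. for every $\vec z\in Z^N$ the minimizer $\hat f(\vec z,\lambda_N)$ exists and is unique; 2. if the empirical measure of $\vec z$ lies in $\mathcal M_{Z,M_3}$, then $\|\hat f(\vec z,\lambda_N)\|_k<\beta$; in particular $\hat f(\vec z,\lambda_N)$ lies in the interior of $\mathcal F$ when $\mathcal F=\{f:\|f\|_k\le\beta\}$; 3. for all $\vec z,\vec z'\in Z^N$, $\ \|\hat f(\vec z,\lambda_N)-\hat f(\vec z',\lambda_N)\|_k\le\frac{C}{N\lambda_N}\sum_{i=1}^N\|z^i-z'^i\|$; 4. for all $P,Q\in\mathcal M_{Z,M_3}$, $$\mathsf d_K\big(P^{\otimes N}\circ\hat f(\cdot,\lambda_N)^{-1},\,Q^{\otimes N}\circ\hat f(\cdot,\lambda_N)^{-1}\big)\le\widetilde C\,\mathsf d_K(P,Q),\qquad \widetilde C=\frac C\tau,$$ where $\mathsf d_K$ is the Kantorovich distance, $\mathsf d_K(\mu,\nu)=\sup\{|\int h\,d\mu-\int h\,d\nu|: h \text{ 1-Lipschitz}\}$,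 taken with respect to $\|\cdot\|$ on $Z$ and $\|\cdot\|_k$ on $\mathcal H_k$. -/

import Mathlib

open MeasureTheory
open scoped ENNReal

noncomputable section

namespace KernelRobust

section Data

variable {E : Type*} [NormedAddCommGroup E] [NormedSpace ℝ E]

/-- A data point `z = (x, y)` of `Z = X × Y`, seen as a vector of the ambient space `E × ℝ`. -/
def vec {X : Set E} {Y : Set ℝ} (z : X × Y) : E × ℝ := ((z.1 : E), (z.2 : ℝ))

/-- `‖z' - z''‖` for the chosen norm `nZ` on the ambient space of the data. -/
def dataDist (nZ : Seminorm ℝ (E × ℝ)) {X : Set E} {Y : Set ℝ} (z' z'' : X × Y) : ℝ :=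
  nZ (vec z' - vec z'')

/-- `L_p(z', z'') = max {1, ‖z'‖, ‖z''‖} ^ (p - 1)`. -/
def growthWeight (nZ : Seminorm ℝ (E × ℝ)) {X : Set E} {Y : Set ℝ} (p : ℝ) (z' z'' : X × Y) : ℝ :=
  (max 1 (max (nZ (vec z')) (nZ (vec z'')))) ^ (p - 1)

end Data

section Measures

/-- A gauge function: continuous, nonnegative and at least `1` outside some compact set. -/
def IsGauge {S : Type*} [TopologicalSpace S] (ψ : S → ℝ) : Prop :=
  Continuous ψ ∧ (∀ z, 0 ≤ ψ z) ∧ ∃ K : Set S, IsCompact K ∧ ∀ z ∉ K, 1 ≤ ψ z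

/-- The probability measures `P'` with `∫ ψ dP' ≤ M`. -/
def momentSet {S : Type*} [MeasurableSpace S] (ψ : S → ℝ) (M : ℝ) : Set (Measure S) :=
  {P | IsProbabilityMeasure P ∧ ∫⁻ z, ENNReal.ofReal (ψ z) ∂P ≤ ENNReal.ofReal M}

/-- The empirical measure `(1 / N) ∑ δ_{zⁱ}` of a sample. -/
def empiricalMeasure {S : Type*} [MeasurableSpace S] {N : ℕ} (s : Fin N → S) : Measure S :=
  (N : ℝ≥0∞)⁻¹ • ∑ i, Measure.dirac (s i)

/-- The Kantorovich distance with respect to a distance function `d`: the supremum of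
`|∫ h dμ - ∫ h dν|` over all `h` with `|h a - h b| ≤ d a b`. -/
def kantorovich {S : Type*} [MeasurableSpace S] (d : S → S → ℝ) (μ ν : Measure S) : ℝ≥0∞ :=
  ⨆ h : {h : S → ℝ // ∀ a b, |h a - h b| ≤ d a b},
    ENNReal.ofReal |∫ z, h.1 z ∂μ - ∫ z, h.1 z ∂ν|

end Measures

section Estimator

variable {E : Type*} [NormedAddCommGroup E] [NormedSpace ℝ E] [MeasurableSpace E]
  {X : Set E} {Y : Set ℝ}
  {H : Type*} [NormedAddCommGroup H] [InnerProductSpace ℝ H] [RKHS ℝ H X ℝ]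

/-- The feature `k_x = k(·, x)` of the reproducing kernel of `H`, so that `f x = ⟪f, k_x⟫`. -/
def feature (H : Type*) [NormedAddCommGroup H] [InnerProductSpace ℝ H] [RKHS ℝ H X ℝ]
    [CompleteSpace H] (x : X) : H :=
  RKHS.kerFun H x (1 : ℝ)

/-- The regularized risk `R_Q^λ(f) = E_Q[c(z, f(x))] + λ ‖f‖²`. -/
def regRisk (c : X × Y → ℝ → ℝ) (Q : Measure (X × Y)) (lam : ℝ) (f : H) : ℝ :=
  ∫ z, c z (f z.1) ∂Q + lam * ‖f‖ ^ 2

/-- `f` is an optimal solution of `min_{f ∈ F} R_Q^λ(f)`. -/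
def IsRegMin (c : X × Y → ℝ → ℝ) (F : Set H) (Q : Measure (X × Y)) (lam : ℝ) (f : H) : Prop :=
  f ∈ F ∧ ∀ g ∈ F, regRisk c Q lam f ≤ regRisk c Q lam g

/-- The kernel learning estimator: a minimizer over `F` of the regularized empirical risk. -/
def estimator (c : X × Y → ℝ → ℝ) (F : Set H) (lam : ℝ) {N : ℕ} (s : Fin N → X × Y) : H :=
  Classical.epsilon (IsRegMin c F (empiricalMeasure s) lam)

/-- The law on `H` of the estimator when the `N` data are independent with distribution `P`. -/
def estimatorLaw [MeasurableSpace H] (c : X × Y → ℝ → ℝ) (F : Set H) (lam : ℝ) (N : ℕ)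
    (P : Measure (X × Y)) : Measure H :=
  (Measure.pi fun _ : Fin N => P).map (estimator c F lam)

/-- The constant `L (1 + β L_k) sup_x ‖k_x‖ + L_k sup_{z, f ∈ F} |c₂'(z, f(x))|`, where
`L = C₁ sup_z L_p(z, z)` and `L_k` is the Lipschitz constant of `x ↦ k_x`. -/
def lipConst [CompleteSpace H] (nZ : Seminorm ℝ (E × ℝ)) (c : X × Y → ℝ → ℝ) (F : Set H)
    (β C₁ p Lk : ℝ) : ℝ :=
  (C₁ * ⨆ z : X × Y, growthWeight nZ p z z) * (1 + β * Lk) * (⨆ x : X, ‖feature H x‖) +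
    Lk * ⨆ q : (X × Y) × F, |deriv (c q.1) ((q.2 : H) q.1.1)|

end Estimator

end KernelRobust

end

open KernelRobust

/-! The penalty `lam * ‖f‖ ^ 2` makes the regularized risk strongly convex. The midpoint inequality
`norm_sub_sq_le_of_convexOn` turns every minimizing sequence into a Cauchy sequence and forces two
minimizers to coincide. Comparing the minimizer with `0 ∈ F` gives `lam * ‖f‖ ^ 2 ≤ M₃`, hence norm
below `β`.

For stability, the variational inequality of each of two minimizers is tested at the other one and
the two are added (`IsRegMin.norm_sub_le`). Convexity of the cost and the penalty bound `2 * lam *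
‖f - f'‖` by the mean change of the loss gradient `c₂'(z, f(x)) k_x` at one fixed `f`. That gradient
is Lipschitz in `z` with constant `lipConst` (`norm_deriv_smul_feature_sub_le`). Only the inequality
form of optimality is used, so minimizers on the boundary of `F` are covered too.

The laws are compared by exchanging `P` for `Q` one coordinate at a time (`abs_integral_pi_sub_le`).
This costs a factor `N`, which the `1 / N` in the sample Lipschitz constant cancels.

The bound on `L_p(z, z)` with `p ≥ 2` makes `Z` bounded. Hence the suprema in `lipConst` are finite,
Lipschitz functions are integrable and Kantorovich distances on `Z` are finite. -/

section

open MeasureTheory Filter Topology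
open scoped ENNReal InnerProductSpace

namespace KernelRobust

/-! ### Strongly convex minimization in Hilbert space. -/

section Minimization

variable {H : Type*} [NormedAddCommGroup H] [InnerProductSpace ℝ H]

/-- A convex function plus `lam ‖·‖²` is strongly convex at midpoints. -/
lemma norm_sub_sq_le_of_convexOn {F : Set H} {G : H → ℝ} (hG : ConvexOn ℝ F G) {lam : ℝ}
    {f g : H} (hf : f ∈ F) (hg : g ∈ F) :
    lam / 2 * ‖f - g‖ ^ 2 ≤ (G f + lam * ‖f‖ ^ 2) + (G g + lam * ‖g‖ ^ 2) -
      2 * (G ((1 / 2 : ℝ) • f + (1 / 2 : ℝ) • g) +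
        lam * ‖(1 / 2 : ℝ) • f + (1 / 2 : ℝ) • g‖ ^ 2) := by
  have h1 := hG.2 hf hg (by norm_num : (0 : ℝ) ≤ 1 / 2) (by norm_num : (0 : ℝ) ≤ 1 / 2)
    (by norm_num)
  have h2 : ‖(1 / 2 : ℝ) • f + (1 / 2 : ℝ) • g‖ ^ 2 = 1 / 4 * ‖f + g‖ ^ 2 := by
    rw [← smul_add, norm_smul, mul_pow]; norm_num
  have h3 := parallelogram_law_with_norm ℝ f g
  simp only [smul_eq_mul] at h1
  rw [h2]
  linear_combination 2 * h1 + lam / 2 * h3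

/-- A nonnegative continuous convex function plus `lam ‖·‖²` attains its minimum on a nonempty
closed convex set. -/
lemma exists_forall_add_norm_sq_le [CompleteSpace H] {F : Set H} (hFc : IsClosed F)
    (hFne : F.Nonempty) {G : H → ℝ} (hG : ConvexOn ℝ F G) (hGc : Continuous G)
    (hG0 : ∀ f, 0 ≤ G f) {lam : ℝ} (hlam : 0 < lam) :
    ∃ f ∈ F, ∀ g ∈ F, G f + lam * ‖f‖ ^ 2 ≤ G g + lam * ‖g‖ ^ 2 := by
  set J : H → ℝ := fun f => G f + lam * ‖f‖ ^ 2 with hJ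
  have hJc : Continuous J := by fun_prop
  set m := sInf (J '' F) with hm
  have hbdd : BddBelow (J '' F) := by
    refine ⟨0, ?_⟩
    rintro _ ⟨f, -, rfl⟩
    have := hG0 f
    positivity
  have hmle : ∀ g ∈ F, m ≤ J g := fun g hg => csInf_le hbdd ⟨g, hg, rfl⟩
  have hex : ∀ n : ℕ, ∃ f ∈ F, J f < m + 1 / ((n : ℝ) + 1) := by
    intro n
    obtain ⟨_, ⟨f, hf, rfl⟩, hlt⟩ := exists_lt_of_csInf_lt (hFne.image J)
      (show sInf (J '' F) < m + 1 / ((n : ℝ) + 1) by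
        have : (0 : ℝ) < 1 / ((n : ℝ) + 1) := by positivity
        linarith)
    exact ⟨f, hf, hlt⟩
  choose u huF hu using hex
  have hcauchy : CauchySeq u := by
    rw [Metric.cauchySeq_iff']
    intro ε hε
    -- For `k ≥ n` both values lie within `1 / (n + 1)` of the infimum `m` and the midpoint value is
    -- at least `m`, so `lam / 2 * ‖u k - u n‖ ^ 2 < 2 / (n + 1)`; hence the tolerance `lam / 4 * ε
    -- ^ 2`.
    obtain ⟨n, hn⟩ := exists_nat_one_div_lt (show (0 : ℝ) < lam / 4 * ε ^ 2 by positivity)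
    refine ⟨n, fun k hk => ?_⟩
    have h1 := norm_sub_sq_le_of_convexOn hG (lam := lam) (huF k) (huF n)
    have h2 := hmle _ (hG.1 (huF k) (huF n) (by norm_num : (0 : ℝ) ≤ 1 / 2)
      (by norm_num : (0 : ℝ) ≤ 1 / 2) (by norm_num))
    have h3 : 1 / ((k : ℝ) + 1) ≤ 1 / ((n : ℝ) + 1) := Nat.one_div_le_one_div hk
    have h4 := hu k
    have h5 := hu n
    simp only [hJ] at h2 h4 h5
    rw [dist_eq_norm]
    have h6 : lam / 2 * ‖u k - u n‖ ^ 2 < lam / 2 * ε ^ 2 := by linarith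
    exact lt_of_pow_lt_pow_left₀ 2 hε.le (lt_of_mul_lt_mul_left h6 (by positivity))
  obtain ⟨f, hf⟩ := cauchySeq_tendsto_of_complete hcauchy
  refine ⟨f, hFc.mem_of_tendsto hf (Eventually.of_forall huF), fun g hg => ?_⟩
  have hlim : Tendsto (fun n => J (u n)) atTop (𝓝 (J f)) := (hJc.tendsto f).comp hf
  have hlim2 : Tendsto (fun n : ℕ => m + 1 / ((n : ℝ) + 1)) atTop (𝓝 (m + 0)) :=
    tendsto_const_nhds.add tendsto_one_div_add_atTop_nhds_zero_nat
  have := le_of_tendsto_of_tendsto' hlim hlim2 (fun n => (hu n).le)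
  exact (this.trans (by simp)).trans (hmle g hg)

lemma eq_of_forall_add_norm_sq_le {F : Set H} {G : H → ℝ} (hG : ConvexOn ℝ F G)
    {lam : ℝ} (hlam : 0 < lam) {f g : H} (hf : f ∈ F) (hg : g ∈ F)
    (hfmin : ∀ h ∈ F, G f + lam * ‖f‖ ^ 2 ≤ G h + lam * ‖h‖ ^ 2)
    (hgmin : ∀ h ∈ F, G g + lam * ‖g‖ ^ 2 ≤ G h + lam * ‖h‖ ^ 2) : f = g := by
  have h1 := norm_sub_sq_le_of_convexOn hG (lam := lam) hf hg
  have hmem := hG.1 hf hg (by norm_num : (0 : ℝ) ≤ 1 / 2) (by norm_num : (0 : ℝ) ≤ 1 / 2)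
    (by norm_num)
  have h2 := hfmin _ hmem
  have h3 := hgmin _ hmem
  have h4 : ‖f - g‖ ^ 2 ≤ 0 := by
    by_contra! h
    have : 0 < lam / 2 * ‖f - g‖ ^ 2 := by positivity
    linarith
  have h5 : ‖f - g‖ = 0 := by
    have := le_antisymm h4 (sq_nonneg _)
    exact pow_eq_zero_iff (two_ne_zero) |>.1 this
  exact sub_eq_zero.1 (norm_eq_zero.1 h5)

end Minimization

/-! ### Integrals against empirical measures. -/

section EmpiricalMeasure

lemma integral_empiricalMeasure {S : Type*} [MeasurableSpace S] [MeasurableSingletonClass S]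
    {N : ℕ} (s : Fin N → S) (g : S → ℝ) :
    ∫ z, g z ∂(empiricalMeasure s) = (N : ℝ)⁻¹ * ∑ i, g (s i) := by
  rw [empiricalMeasure, integral_smul_measure,
    integral_finsetSum_measure (fun i _ => integrable_dirac (by simp))]
  simp

lemma sum_le_of_empiricalMeasure_mem_momentSet {S : Type*} [MeasurableSpace S]
    [MeasurableSingletonClass S] {N : ℕ} (s : Fin N → S) {ψ : S → ℝ}
    (hψ0 : ∀ z, 0 ≤ ψ z) {M : ℝ} (hM : 0 ≤ M)
    (h : empiricalMeasure s ∈ momentSet ψ M) : (N : ℝ)⁻¹ * ∑ i, ψ (s i) ≤ M := by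
  have h2 := h.2
  have hint : Integrable ψ (empiricalMeasure s) := by
    have := h.1
    rw [empiricalMeasure]
    -- For `N = 0` the scalar is `∞` and the finite-scalar argument fails, but the empty sum makes
    -- the measure zero.
    rcases Nat.eq_zero_or_pos N with rfl | hN
    · simp
    · refine Integrable.smul_measure ?_ (by simp [hN.ne'])
      exact integrable_finsetSum_measure.2 fun i _ => integrable_dirac (by simp)
  rw [← ofReal_integral_eq_lintegral_ofReal hint (Eventually.of_forall hψ0),
    ENNReal.ofReal_le_ofReal_iff hM, integral_empiricalMeasure] at h2
  exact h2

end EmpiricalMeasure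

/-! ### Kantorovich distance and product measures. -/

section Kantorovich

variable {S : Type*} [MeasurableSpace S] {d : S → S → ℝ}

/-- A continuous `e` vanishing on the diagonal stands in for a metric, so that `dataDist` and its
sums over samples are treated alike. -/
lemma continuous_of_abs_sub_le {T : Type*} [TopologicalSpace T] {e : T → T → ℝ}
    (he : Continuous fun q : T × T => e q.1 q.2) (he0 : ∀ a, e a a = 0) {V : Type*}
    [SeminormedAddCommGroup V] {g : T → V} (hg : ∀ s t, ‖g s - g t‖ ≤ e s t) : Continuous g := by
  rw [continuous_iff_continuousAt]
  intro t
  rw [ContinuousAt, tendsto_iff_norm_sub_tendsto_zero]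
  have h : Tendsto (fun s => e s t) (𝓝 t) (𝓝 0) := by
    have : Continuous fun s => e s t := he.comp (by fun_prop : Continuous fun s => (s, t))
    simpa [he0] using this.tendsto t
  exact squeeze_zero (fun _ => norm_nonneg _) (fun s => hg s t) h

/-- Bounded oscillation makes the function bounded. Integrability matters because Bochner integrals
default to `0` without it. -/
lemma integrable_of_abs_sub_le {T : Type*} [TopologicalSpace T] [MeasurableSpace T]
    [OpensMeasurableSpace T] {μ : Measure T} [IsFiniteMeasure μ] {e : T → T → ℝ}
    (he : Continuous fun q : T × T => e q.1 q.2) (he0 : ∀ a, e a a = 0) {D : ℝ}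
    (hD : ∀ a b, e a b ≤ D) {g : T → ℝ} (hg : ∀ s t, |g s - g t| ≤ e s t) : Integrable g μ := by
  rcases isEmpty_or_nonempty T with hT | ⟨⟨t⟩⟩
  · rw [Measure.eq_zero_of_isEmpty μ]; exact integrable_zero_measure
  refine Integrable.of_bound (continuous_of_abs_sub_le he he0 hg).measurable.aestronglyMeasurable
    (|g t| + D) (Eventually.of_forall fun s => ?_)
  have h1 := (hg s t).trans (hD s t)
  have h2 := abs_add_le (g s - g t) (g t)
  rw [sub_add_cancel] at h2
  rw [Real.norm_eq_abs]
  linarith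

lemma abs_integral_sub_le_mul {P Q : Measure S} [IsProbabilityMeasure P] [IsProbabilityMeasure Q]
    {W : ℝ} (hW : ∀ h : S → ℝ, (∀ a b, |h a - h b| ≤ d a b) →
      |∫ z, h z ∂P - ∫ z, h z ∂Q| ≤ W)
    {K : ℝ} (hK : 0 ≤ K) {g : S → ℝ} (hg : ∀ a b, |g a - g b| ≤ K * d a b) :
    |∫ z, g z ∂P - ∫ z, g z ∂Q| ≤ K * W := by
  -- Rescaling by `K⁻¹` needs `K > 0`; for `K = 0` the function is constant.
  rcases hK.eq_or_lt with rfl | hK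
  · obtain ⟨a⟩ : Nonempty S := nonempty_of_isProbabilityMeasure P
    have : g = fun _ => g a := by
      funext b
      have := hg b a
      rw [zero_mul] at this
      exact sub_eq_zero.1 (abs_nonpos_iff.1 this)
    rw [this]; simp
  · have h1 := hW (fun z => K⁻¹ * g z) fun a b => by
      rw [← mul_sub, abs_mul, abs_of_pos (inv_pos.2 hK), inv_mul_le_iff₀ hK]
      exact hg a b
    rw [integral_const_mul, integral_const_mul, ← mul_sub, abs_mul, abs_of_pos (inv_pos.2 hK),
      inv_mul_le_iff₀ hK] at h1
    exact h1

variable [TopologicalSpace S] [OpensMeasurableSpace S]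

/-- On a bounded space the Kantorovich distance of probability measures is finite. -/
lemma kantorovich_ne_top {P Q : Measure S} [IsProbabilityMeasure P] [IsProbabilityMeasure Q]
    (hd : Continuous fun q : S × S => d q.1 q.2) (hd0 : ∀ a, d a a = 0)
    {D : ℝ} (hD : ∀ a b, d a b ≤ D) : kantorovich d P Q ≠ ∞ := by
  obtain ⟨a⟩ : Nonempty S := nonempty_of_isProbabilityMeasure P
  refine ne_top_of_le_ne_top (ENNReal.ofReal_ne_top (r := 2 * D)) (iSup_le fun h => ?_)
  refine ENNReal.ofReal_le_ofReal ?_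
  have hbd : ∀ (μ : Measure S) [IsProbabilityMeasure μ], |∫ z, h.1 z ∂μ - h.1 a| ≤ D := by
    intro μ _
    have hi : Integrable h.1 μ := integrable_of_abs_sub_le hd hd0 hD h.2
    have : ∫ z, h.1 z ∂μ - h.1 a = ∫ z, (h.1 z - h.1 a) ∂μ := by
      rw [integral_sub hi (integrable_const _)]; simp
    rw [this, ← Real.norm_eq_abs]
    exact (norm_integral_le_of_norm_le_const (C := D) (Eventually.of_forall
      fun z => (h.2 z a).trans (hD z a))).trans (by simp)
  have h1 := hbd P
  have h2 := hbd Q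
  have h3 := abs_sub_le (∫ z, h.1 z ∂P) (h.1 a) (∫ z, h.1 z ∂Q)
  rw [abs_sub_comm (h.1 a)] at h3
  linarith

variable [SecondCountableTopology S]

/-- Tensorization: a function on `Sⁿ` that is `K`-Lipschitz for the sum distance has integrals
against `Pⁿ` and `Qⁿ` that differ by at most `n K` times the Kantorovich distance. -/
lemma abs_integral_pi_sub_le {P Q : Measure S} [IsProbabilityMeasure P] [IsProbabilityMeasure Q]
    (hd : Continuous fun q : S × S => d q.1 q.2) (hd0 : ∀ a, d a a = 0)
    {D : ℝ} (hD : ∀ a b, d a b ≤ D)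
    {W : ℝ} (hW : ∀ h : S → ℝ, (∀ a b, |h a - h b| ≤ d a b) →
      |∫ z, h z ∂P - ∫ z, h z ∂Q| ≤ W)
    {K : ℝ} (hK : 0 ≤ K) {n : ℕ} {g : (Fin n → S) → ℝ}
    (hg : ∀ s t, |g s - g t| ≤ K * ∑ i, d (s i) (t i)) :
    |∫ s, g s ∂(Measure.pi fun _ => P) - ∫ s, g s ∂(Measure.pi fun _ => Q)| ≤ n * K * W := by
  induction n with
  | zero => rw [Measure.pi_of_empty (fun _ => P), Measure.pi_of_empty (fun _ => Q)]; simp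
  | succ n ih =>
    have hsum : ∀ m : ℕ, Continuous fun q : (Fin m → S) × (Fin m → S) =>
        K * ∑ i, d (q.1 i) (q.2 i) := fun m =>
      continuous_const.mul (continuous_finsetSum _ fun i _ =>
        hd.comp (by fun_prop : Continuous fun q : (Fin m → S) × (Fin m → S) => (q.1 i, q.2 i)))
    have hsumD : ∀ (m : ℕ) (s t : Fin m → S), K * ∑ i, d (s i) (t i) ≤ K * (m * D) := by
      intro m s t
      refine mul_le_mul_of_nonneg_left ?_ hK
      exact (Finset.sum_le_sum fun i _ => hD (s i) (t i)).trans (by simp)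
    have hint : ∀ (μ : Measure (Fin n → S)) [IsProbabilityMeasure μ] (z : S),
        Integrable (fun t => g (Fin.cons z t)) μ := fun μ _ z =>
      integrable_of_abs_sub_le (hsum n) (by simp [hd0]) (hsumD n) fun s t => by
        simpa [Fin.sum_univ_succ, hd0] using hg (Fin.cons z s) (Fin.cons z t)
    have hlip : ∀ (μ : Measure (Fin n → S)) [IsProbabilityMeasure μ] (a b : S),
        |∫ t, g (Fin.cons a t) ∂μ - ∫ t, g (Fin.cons b t) ∂μ| ≤ K * d a b := by
      intro μ _ a b
      rw [← integral_sub (hint μ a) (hint μ b), ← Real.norm_eq_abs]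
      refine (norm_integral_le_of_norm_le_const (C := K * d a b) (Eventually.of_forall
        fun t => ?_)).trans (by simp)
      simpa [Fin.sum_univ_succ, hd0] using hg (Fin.cons a t) (Fin.cons b t)
    have hfub : ∀ (μ : Measure S) [IsProbabilityMeasure μ],
        ∫ s, g s ∂(Measure.pi fun _ => μ) =
          ∫ z, ∫ t, g (Fin.cons z t) ∂(Measure.pi fun _ : Fin n => μ) ∂μ := by
      intro μ _
      have hmp := (measurePreserving_piFinSuccAbove (fun _ : Fin (n + 1) => μ) 0).symm
      have hI : Integrable g (Measure.pi fun _ : Fin (n + 1) => μ) :=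
        integrable_of_abs_sub_le (hsum (n + 1)) (by simp [hd0]) (hsumD (n + 1)) hg
      rw [← hmp.integral_comp', integral_prod]
      · simp [MeasurableEquiv.piFinSuccAbove_symm_apply, Fin.insertNthEquiv]
      · exact (hmp.integrable_comp_emb (MeasurableEquiv.measurableEmbedding _)).2 hI
    rw [hfub P, hfub Q]
    set A : S → ℝ := fun z => ∫ t, g (Fin.cons z t) ∂(Measure.pi fun _ : Fin n => P) with hA
    set B : S → ℝ := fun z => ∫ t, g (Fin.cons z t) ∂(Measure.pi fun _ : Fin n => Q) with hB
    have hKd : Continuous fun q : S × S => K * d q.1 q.2 := continuous_const.mul hd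
    have hKD : ∀ a b, K * d a b ≤ K * D := fun a b => mul_le_mul_of_nonneg_left (hD a b) hK
    have hAi : Integrable A Q := integrable_of_abs_sub_le hKd (by simp [hd0]) hKD (hlip _)
    have hBi : Integrable B Q := integrable_of_abs_sub_le hKd (by simp [hd0]) hKD (hlip _)
    -- Hybrid step: `h1` exchanges the measure in coordinate `0`, where `A` is `K`-Lipschitz; `h2`
    -- exchanges the other `n` coordinates with `z` frozen.
    have h1 : |∫ z, A z ∂P - ∫ z, A z ∂Q| ≤ K * W := abs_integral_sub_le_mul hW hK (hlip _)
    have h2 : |∫ z, A z ∂Q - ∫ z, B z ∂Q| ≤ n * K * W := by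
      rw [← integral_sub hAi hBi, ← Real.norm_eq_abs]
      refine (norm_integral_le_of_norm_le_const (C := n * K * W) (Eventually.of_forall
        fun z => ?_)).trans (by simp)
      refine ih fun s t => ?_
      simpa [Fin.sum_univ_succ, hd0] using hg (Fin.cons z s) (Fin.cons z t)
    have h3 := abs_sub_le (∫ z, A z ∂P) (∫ z, A z ∂Q) (∫ z, B z ∂Q)
    push_cast
    linarith

/-- A statistic that is `K`-Lipschitz for the sum distance contracts Kantorovich distances up to
the factor `n K`. -/
lemma kantorovich_map_pi_le {P Q : Measure S} [IsProbabilityMeasure P] [IsProbabilityMeasure Q]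
    (hd : Continuous fun q : S × S => d q.1 q.2) (hd0 : ∀ a, d a a = 0)
    {D : ℝ} (hD : ∀ a b, d a b ≤ D) {V : Type*} [NormedAddCommGroup V] [MeasurableSpace V]
    [BorelSpace V] {K : ℝ} (hK : 0 ≤ K) {n : ℕ} {T : (Fin n → S) → V}
    (hT : ∀ s t, ‖T s - T t‖ ≤ K * ∑ i, d (s i) (t i)) :
    kantorovich (fun f g : V => ‖f - g‖) ((Measure.pi fun _ => P).map T)
      ((Measure.pi fun _ => Q).map T) ≤ ENNReal.ofReal (n * K) * kantorovich d P Q := by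
  have hfin := kantorovich_ne_top (P := P) (Q := Q) hd hd0 hD
  have hW : ∀ h : S → ℝ, (∀ a b, |h a - h b| ≤ d a b) →
      |∫ z, h z ∂P - ∫ z, h z ∂Q| ≤ (kantorovich d P Q).toReal := fun h hh =>
    (ENNReal.ofReal_le_iff_le_toReal hfin).1 (le_iSup
      (fun h : {h : S → ℝ // ∀ a b, |h a - h b| ≤ d a b} =>
        ENNReal.ofReal |∫ z, h.1 z ∂P - ∫ z, h.1 z ∂Q|) ⟨h, hh⟩)
  have hTc : Continuous T := by
    refine continuous_of_abs_sub_le ?_ (by simp [hd0]) hT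
    exact continuous_const.mul (continuous_finsetSum _ fun i _ =>
      hd.comp (by fun_prop : Continuous fun q : (Fin n → S) × (Fin n → S) => (q.1 i, q.2 i)))
  refine iSup_le fun h => ?_
  have hhc : Continuous h.1 :=
    continuous_of_abs_sub_le (e := fun f g : V => ‖f - g‖) (by fun_prop) (by simp) h.2
  rw [integral_map hTc.measurable.aemeasurable hhc.measurable.aestronglyMeasurable,
    integral_map hTc.measurable.aemeasurable hhc.measurable.aestronglyMeasurable,
    ← ENNReal.ofReal_toReal hfin, ← ENNReal.ofReal_mul (by positivity)]
  refine ENNReal.ofReal_le_ofReal (abs_integral_pi_sub_le hd hd0 hD hW hK fun s t => ?_)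
  exact (h.2 _ _).trans (hT s t)

end Kantorovich

/-! ### Data distance and growth weights. -/

section DataDist

variable {E : Type*} [NormedAddCommGroup E] [NormedSpace ℝ E] {X : Set E} {Y : Set ℝ}
  {nZ : Seminorm ℝ (E × ℝ)}

lemma dataDist_nonneg (z z' : X × Y) : 0 ≤ dataDist nZ z z' := apply_nonneg _ _

lemma dataDist_self (z : X × Y) : dataDist nZ z z = 0 := by simp [dataDist]

lemma norm_sub_le_dataDist (hnX : ∀ x y, ‖x‖ ≤ nZ (x, y)) (z z' : X × Y) :
    ‖(z.1 : E) - z'.1‖ ≤ dataDist nZ z z' := by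
  simpa [dataDist, vec] using hnX ((z.1 : E) - z'.1) ((z.2 : ℝ) - z'.2)

lemma dataDist_le_add (z z' : X × Y) : dataDist nZ z z' ≤ nZ (vec z) + nZ (vec z') :=
  map_sub_le_add nZ _ _

/-- `nZ` is not tied to the topology of `E × ℝ`, but a convex function on a finite-dimensional space
is continuous. -/
lemma continuous_dataDist [FiniteDimensional ℝ E] :
    Continuous fun q : (X × Y) × (X × Y) => dataDist nZ q.1 q.2 := by
  have h : Continuous nZ := by
    rw [← continuousOn_univ]
    exact nZ.convexOn.continuousOn isOpen_univ
  unfold dataDist vec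
  exact h.comp (by fun_prop)

lemma growthWeight_nonneg (p : ℝ) (z z' : X × Y) : 0 ≤ growthWeight nZ p z z' :=
  Real.rpow_nonneg (zero_le_one.trans (le_max_left _ _)) _

/-- The off-diagonal weights are bounded by the diagonal weights of any larger exponent. -/
lemma growthWeight_le_iSup {p q : ℝ} (hpq : p ≤ q)
    (hL : BddAbove (Set.range fun z : X × Y => growthWeight nZ q z z)) (z z' : X × Y) :
    growthWeight nZ p z z' ≤ ⨆ z : X × Y, growthWeight nZ q z z := by
  have h1 : growthWeight nZ p z z' ≤ growthWeight nZ q z z' :=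
    Real.rpow_le_rpow_of_exponent_le (le_max_left _ _) (by linarith)
  refine h1.trans ?_
  rcases le_total (nZ (vec z)) (nZ (vec z')) with h | h
  · have h2 : growthWeight nZ q z z' = growthWeight nZ q z' z' := by simp [growthWeight, h]
    rw [h2]
    exact le_ciSup hL z'
  · have h2 : growthWeight nZ q z z' = growthWeight nZ q z z := by simp [growthWeight, h]
    rw [h2]
    exact le_ciSup hL z

/-- With exponent `p - 1 ≥ 1` and base at least `1`, the weight dominates `nZ (vec z)`; a bounded
weight thus means bounded data. -/
lemma exists_seminorm_vec_le {p : ℝ} (hp : 2 ≤ p)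
    (hL : BddAbove (Set.range fun z : X × Y => growthWeight nZ p z z)) :
    ∃ B, ∀ z : X × Y, nZ (vec z) ≤ B := by
  obtain ⟨B, hB⟩ := hL
  refine ⟨B, fun z => le_trans ?_ (hB ⟨z, rfl⟩)⟩
  have h1 : (1 : ℝ) ≤ max 1 (max (nZ (vec z)) (nZ (vec z))) := le_max_left _ _
  have h2 := Real.rpow_le_rpow_of_exponent_le h1 (by linarith : (1 : ℝ) ≤ p - 1)
  rw [Real.rpow_one] at h2
  exact le_trans (by simp) h2

end DataDist

/-! ### Optimality and stability of the estimator. -/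

section Estimator

variable {E : Type*} {X : Set E} {Y : Set ℝ}
  {H : Type*} [NormedAddCommGroup H] [InnerProductSpace ℝ H] [RKHS ℝ H X ℝ]

lemma apply_eq_inner_feature [CompleteSpace H] (f : H) (x : X) :
    f x = ⟪f, feature H x⟫_ℝ := by
  simp [feature]

lemma abs_apply_le [CompleteSpace H] (f : H) (x : X) : |f x| ≤ ‖f‖ * ‖feature H x‖ := by
  rw [apply_eq_inner_feature]
  exact abs_real_inner_le_norm _ _

lemma abs_apply_sub_apply_le [CompleteSpace H] (f : H) (x x' : X) :
    |f x - f x'| ≤ ‖f‖ * ‖feature H x - feature H x'‖ := by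
  rw [apply_eq_inner_feature, apply_eq_inner_feature, ← inner_sub_right]
  exact abs_real_inner_le_norm _ _

lemma convexOn_empiricalRisk {c : X × Y → ℝ → ℝ} (hC1 : ∀ z, ConvexOn ℝ Set.univ (c z)) {F : Set H}
    (hF : Convex ℝ F) {N : ℕ} (s : Fin N → X × Y) :
    ConvexOn ℝ F fun f : H => (N : ℝ)⁻¹ * ∑ i, c (s i) (f (s i).1) := by
  refine ⟨hF, fun f _ g _ a b ha hb hab => ?_⟩
  have h : ∑ i, c (s i) ((a • f + b • g) (s i).1) ≤
      ∑ i, (a * c (s i) (f (s i).1) + b * c (s i) (g (s i).1)) :=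
    Finset.sum_le_sum fun i _ => by
      simpa using (hC1 (s i)).2 (Set.mem_univ (f (s i).1)) (Set.mem_univ (g (s i).1)) ha hb hab
  rw [Finset.sum_add_distrib, ← Finset.mul_sum, ← Finset.mul_sum] at h
  have hN : (0 : ℝ) ≤ (N : ℝ)⁻¹ := by positivity
  have h2 := mul_le_mul_of_nonneg_left h hN
  simp only [smul_eq_mul]
  linarith

variable [NormedAddCommGroup E] [MeasurableSpace E] [BorelSpace E]

lemma regRisk_empiricalMeasure (c : X × Y → ℝ → ℝ) {N : ℕ} (s : Fin N → X × Y) (lam : ℝ) (f : H) :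
    regRisk c (empiricalMeasure s) lam f =
      (N : ℝ)⁻¹ * ∑ i, c (s i) (f (s i).1) + lam * ‖f‖ ^ 2 := by
  rw [regRisk, integral_empiricalMeasure]

lemma isRegMin_empiricalMeasure_iff {c : X × Y → ℝ → ℝ} {F : Set H} {N : ℕ} {s : Fin N → X × Y}
    {lam : ℝ} {f : H} : IsRegMin c F (empiricalMeasure s) lam f ↔ f ∈ F ∧ ∀ g ∈ F,
      (N : ℝ)⁻¹ * ∑ i, c (s i) (f (s i).1) + lam * ‖f‖ ^ 2 ≤
        (N : ℝ)⁻¹ * ∑ i, c (s i) (g (s i).1) + lam * ‖g‖ ^ 2 := by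
  simp only [IsRegMin, regRisk_empiricalMeasure]

lemma IsRegMin.eq {c : X × Y → ℝ → ℝ} (hC1 : ∀ z, ConvexOn ℝ Set.univ (c z)) {F : Set H}
    (hF : Convex ℝ F) {N : ℕ} {s : Fin N → X × Y} {lam : ℝ} (hlam : 0 < lam) {f g : H}
    (hf : IsRegMin c F (empiricalMeasure s) lam f)
    (hg : IsRegMin c F (empiricalMeasure s) lam g) : f = g := by
  rw [isRegMin_empiricalMeasure_iff] at hf hg
  exact eq_of_forall_add_norm_sq_le (convexOn_empiricalRisk hC1 hF s) hlam hf.1 hg.1 hf.2 hg.2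

lemma isRegMin_estimator [CompleteSpace H] {c : X × Y → ℝ → ℝ} (hc0 : ∀ z w, 0 ≤ c z w)
    (hC1 : ∀ z, ConvexOn ℝ Set.univ (c z)) {F : Set H} (hF : Convex ℝ F) (hFc : IsClosed F)
    (hFne : F.Nonempty) {N : ℕ} (s : Fin N → X × Y) {lam : ℝ} (hlam : 0 < lam) :
    IsRegMin c F (empiricalMeasure s) lam (estimator c F lam s) := by
  refine Classical.epsilon_spec ?_
  have hcont : Continuous fun f : H => (N : ℝ)⁻¹ * ∑ i, c (s i) (f (s i).1) := by
    refine continuous_const.mul (continuous_finsetSum _ fun i _ => ?_)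
    exact (hC1 (s i)).locallyLipschitz.continuous.comp (RKHS.continuous_eval _)
  obtain ⟨f, hf, hmin⟩ := exists_forall_add_norm_sq_le hFc hFne (convexOn_empiricalRisk hC1 hF s)
    hcont (fun f => mul_nonneg (by positivity) (Finset.sum_nonneg fun i _ => hc0 _ _)) hlam
  exact ⟨f, isRegMin_empiricalMeasure_iff.2 ⟨hf, hmin⟩⟩

/-- The minimizer has norm less than `β` when the empirical moment is at most `M`. -/
lemma IsRegMin.norm_lt {c : X × Y → ℝ → ℝ} (hc0 : ∀ z w, 0 ≤ c z w) {F : Set H}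
    (hF0 : (0 : H) ∈ F) {ψ : X × Y → ℝ} (hψ0 : ∀ z, 0 ≤ ψ z)
    (hC2 : ∀ z : X × Y, ∀ f ∈ F, c z (f z.1) ≤ ψ z) {M τ β lam : ℝ} (hM : 0 ≤ M) (hτ : 0 < τ)
    (hβ : √(M / τ) < β) (hlam : τ ≤ lam) {N : ℕ} {s : Fin N → X × Y} {f : H}
    (hs : empiricalMeasure s ∈ momentSet ψ M) (hf : IsRegMin c F (empiricalMeasure s) lam f) :
    ‖f‖ < β := by
  rw [isRegMin_empiricalMeasure_iff] at hf
  have h1 := hf.2 0 hF0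
  have hN : (0 : ℝ) ≤ (N : ℝ)⁻¹ := by positivity
  have h2 : 0 ≤ (N : ℝ)⁻¹ * ∑ i, c (s i) (f (s i).1) :=
    mul_nonneg hN (Finset.sum_nonneg fun i _ => hc0 _ _)
  have h3 : (N : ℝ)⁻¹ * ∑ i, c (s i) ((0 : H) (s i).1) ≤ (N : ℝ)⁻¹ * ∑ i, ψ (s i) :=
    mul_le_mul_of_nonneg_left (Finset.sum_le_sum fun i _ => hC2 _ _ hF0) hN
  have h4 := sum_le_of_empiricalMeasure_mem_momentSet s hψ0 hM hs
  have h5 : τ * ‖f‖ ^ 2 ≤ lam * ‖f‖ ^ 2 := by gcongr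
  have h6 : ‖f‖ ^ 2 ≤ M / τ := by
    rw [le_div_iff₀ hτ]
    simp only [norm_zero] at h1
    linarith
  exact (Real.le_sqrt_of_sq_le h6).trans_lt hβ

/-- First-order optimality of the regularized empirical risk minimizer. -/
lemma IsRegMin.variational_inequality {c : X × Y → ℝ → ℝ} (hcdiff : ∀ z, Differentiable ℝ (c z))
    {F : Set H} (hF : Convex ℝ F) {N : ℕ} {s : Fin N → X × Y} {lam : ℝ} {f g : H}
    (hf : IsRegMin c F (empiricalMeasure s) lam f) (hg : g ∈ F) :
    0 ≤ (N : ℝ)⁻¹ * ∑ i, deriv (c (s i)) (f (s i).1) * (g (s i).1 - f (s i).1) +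
      lam * (2 * ⟪f, g - f⟫_ℝ) := by
  rw [isRegMin_empiricalMeasure_iff] at hf
  set φ : ℝ → ℝ := fun t => (N : ℝ)⁻¹ * ∑ i, c (s i) (f (s i).1 + t * (g (s i).1 - f (s i).1)) +
    lam * ‖f + t • (g - f)‖ ^ 2 with hφ
  have hderiv : HasDerivAt φ ((N : ℝ)⁻¹ * ∑ i, deriv (c (s i)) (f (s i).1) *
      (g (s i).1 - f (s i).1) + lam * (2 * ⟪f, g - f⟫_ℝ)) 0 := by
    refine HasDerivAt.add ?_ ?_
    · refine HasDerivAt.const_mul _ (HasDerivAt.fun_sum fun i _ => ?_)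
      have h1 : HasDerivAt (fun t : ℝ => f (s i).1 + t * (g (s i).1 - f (s i).1))
          (g (s i).1 - f (s i).1) 0 := by
        simpa using ((hasDerivAt_id (0 : ℝ)).mul_const (g (s i).1 - f (s i).1)).const_add
          (f (s i).1)
      refine HasDerivAt.comp (0 : ℝ) (h₂ := c (s i)) ?_ h1
      simpa using (hcdiff (s i) (f (s i).1)).hasDerivAt
    · refine HasDerivAt.const_mul _ ?_
      have h1 : HasDerivAt (fun t : ℝ => f + t • (g - f)) (g - f) 0 := by
        simpa using ((hasDerivAt_id (0 : ℝ)).smul_const (g - f)).const_add f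
      simpa using h1.norm_sq
  have hmin : IsLocalMinOn φ (Set.Icc 0 1) 0 := by
    refine IsMinOn.localize fun t ht => ?_
    have h1 := hf.2 _ (hF.add_smul_sub_mem hf.1 hg ht)
    simpa [hφ] using h1
  -- The segment towards `g` stays in `F` only for `t ∈ [0, 1]`, so the minimum at the endpoint `0`
  -- gives a sign for the derivative, not its vanishing.
  have h := hmin.hasFDerivWithinAt_nonneg hderiv.hasFDerivAt.hasFDerivWithinAt
    (y := 1) (mem_posTangentConeAt_of_segment_subset (by simp [segment_eq_Icc]))
  simpa using h

/-- Stability of the regularized minimizer under a change of the sample. -/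
lemma IsRegMin.norm_sub_le [CompleteSpace H] {c : X × Y → ℝ → ℝ}
    (hC1 : ∀ z, ConvexOn ℝ Set.univ (c z))
    (hcdiff : ∀ z, Differentiable ℝ (c z)) {F : Set H} (hF : Convex ℝ F) {N : ℕ}
    {s s' : Fin N → X × Y} {lam : ℝ} {f f' : H}
    (hf : IsRegMin c F (empiricalMeasure s) lam f)
    (hf' : IsRegMin c F (empiricalMeasure s') lam f') :
    2 * lam * ‖f - f'‖ ≤ (N : ℝ)⁻¹ * ∑ i, ‖deriv (c (s i)) (f (s i).1) • feature H (s i).1 -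
      deriv (c (s' i)) (f (s' i).1) • feature H (s' i).1‖ := by
  have h1 := hf.variational_inequality hcdiff hF hf'.1
  have h2 := hf'.variational_inequality hcdiff hF hf.1
  have hN : (0 : ℝ) ≤ (N : ℝ)⁻¹ := by positivity
  -- Monotonicity of the derivative replaces its value at `f'` by that at `f`. The reproducing
  -- property then makes the sum an inner product of the gradient difference with `f' - f`.
  have hterm : ∀ i, deriv (c (s i)) (f (s i).1) * (f' (s i).1 - f (s i).1) +
      deriv (c (s' i)) (f' (s' i).1) * (f (s' i).1 - f' (s' i).1) ≤
      ‖deriv (c (s i)) (f (s i).1) • feature H (s i).1 -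
        deriv (c (s' i)) (f (s' i).1) • feature H (s' i).1‖ * ‖f - f'‖ := by
    intro i
    have hmono : Monotone (deriv (c (s' i))) := by
      rw [← monotoneOn_univ]
      exact (hC1 (s' i)).monotoneOn_deriv fun x _ => hcdiff (s' i) x
    have h3 : 0 ≤ (deriv (c (s' i)) (f (s' i).1) - deriv (c (s' i)) (f' (s' i).1)) *
        (f (s' i).1 - f' (s' i).1) := by
      rcases le_total (f (s' i).1) (f' (s' i).1) with h | h
      · exact mul_nonneg_of_nonpos_of_nonpos (sub_nonpos.2 (hmono h)) (sub_nonpos.2 h)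
      · exact mul_nonneg (sub_nonneg.2 (hmono h)) (sub_nonneg.2 h)
    have h4 := real_inner_le_norm (deriv (c (s i)) (f (s i).1) • feature H (s i).1 -
        deriv (c (s' i)) (f (s' i).1) • feature H (s' i).1) (f' - f)
    rw [norm_sub_rev f' f] at h4
    refine le_trans ?_ h4
    rw [inner_sub_left, real_inner_smul_left, real_inner_smul_left,
      real_inner_comm (f' - f), real_inner_comm (f' - f), ← apply_eq_inner_feature,
      ← apply_eq_inner_feature]
    simp only [RKHS.coe_sub, Pi.sub_apply]
    linarith
  have hsum := mul_le_mul_of_nonneg_left (Finset.sum_le_sum fun i (_ : i ∈ Finset.univ) => hterm i)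
    hN
  rw [Finset.sum_add_distrib, ← Finset.sum_mul] at hsum
  have h5 : ⟪f, f' - f⟫_ℝ + ⟪f', f - f'⟫_ℝ = -‖f - f'‖ ^ 2 := by
    rw [← real_inner_self_eq_norm_sq]
    simp only [inner_sub_left, inner_sub_right]
    linarith
  have h6 : 2 * lam * ‖f - f'‖ * ‖f - f'‖ ≤ ((N : ℝ)⁻¹ * ∑ i,
      ‖deriv (c (s i)) (f (s i).1) • feature H (s i).1 -
        deriv (c (s' i)) (f (s' i).1) • feature H (s' i).1‖) * ‖f - f'‖ := by
    linear_combination h1 + h2 + hsum + 2 * lam * h5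
  rcases (norm_nonneg (f - f')).eq_or_lt with h | h
  · rw [← h, mul_zero]
    positivity
  · exact le_of_mul_le_mul_right h6 h

end Estimator

/-! ### Finiteness of the constants and the Lipschitz gradient. -/

section Constants

variable {E : Type*} [NormedAddCommGroup E] [NormedSpace ℝ E] {X : Set E} {Y : Set ℝ}
  {nZ : Seminorm ℝ (E × ℝ)}
  {H : Type*} [NormedAddCommGroup H] [InnerProductSpace ℝ H] [CompleteSpace H] [RKHS ℝ H X ℝ]

lemma bddAbove_norm_feature (hnX : ∀ x y, ‖x‖ ≤ nZ (x, y)) {Lk : ℝ} (hLk : 0 ≤ Lk)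
    (hK1 : ∀ x₁ x₂ : X, ‖feature H x₁ - feature H x₂‖ ≤ Lk * ‖(x₁ : E) - x₂‖)
    {B : ℝ} (hB : ∀ z : X × Y, nZ (vec z) ≤ B) (z₀ : X × Y) :
    BddAbove (Set.range fun x : X => ‖feature H x‖) := by
  refine ⟨‖feature H z₀.1‖ + Lk * (B + B), ?_⟩
  rintro _ ⟨x, rfl⟩
  have h1 : ‖(x : E) - z₀.1‖ ≤ B + B :=
    (norm_sub_le_dataDist hnX (x, z₀.2) z₀).trans
      ((dataDist_le_add _ _).trans (add_le_add (hB _) (hB _)))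
  have h2 := (hK1 x z₀.1).trans (mul_le_mul_of_nonneg_left h1 hLk)
  have h3 := norm_le_norm_add_norm_sub' (feature H x) (feature H z₀.1)
  simp only
  linarith

/-- The derivative is compared with its value at `(z₀, 0)`: the data are bounded, and `|f x| ≤ β *
sup ‖k_x‖`. Boundedness is needed since a real `⨆` of an unbounded family is `0`. -/
lemma bddAbove_abs_deriv {F : Set H} {β : ℝ} (hFβ : ∀ f ∈ F, ‖f‖ ≤ β) {c : X × Y → ℝ → ℝ}
    {C₁ p₁ p : ℝ} (hC₁ : 0 ≤ C₁) (hp : p₁ ≤ p)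
    (hC4 : ∀ z₁ z₂ w₁ w₂, |deriv (c z₁) w₁ - deriv (c z₂) w₂| ≤
      C₁ * growthWeight nZ p₁ z₁ z₂ * (dataDist nZ z₁ z₂ + |w₁ - w₂|))
    (hL : BddAbove (Set.range fun z : X × Y => growthWeight nZ p z z))
    {B : ℝ} (hB : ∀ z : X × Y, nZ (vec z) ≤ B)
    (hfeat : BddAbove (Set.range fun x : X => ‖feature H x‖)) (z₀ : X × Y) :
    BddAbove (Set.range fun q : (X × Y) × F => |deriv (c q.1) ((q.2 : H) q.1.1)|) := by
  refine ⟨|deriv (c z₀) 0| + C₁ * (⨆ z : X × Y, growthWeight nZ p z z) *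
    ((B + B) + β * ⨆ x : X, ‖feature H x‖), ?_⟩
  rintro _ ⟨⟨z, f, hf⟩, rfl⟩
  have h1 := hC4 z z₀ (f z.1) 0
  have h2 := growthWeight_le_iSup hp hL z z₀
  have h3 : |f z.1 - 0| ≤ β * ⨆ x : X, ‖feature H x‖ := by
    rw [sub_zero]
    exact (abs_apply_le f z.1).trans (mul_le_mul (hFβ f hf) (le_ciSup hfeat z.1)
      (norm_nonneg _) ((norm_nonneg f).trans (hFβ f hf)))
  have h4 : dataDist nZ z z₀ ≤ B + B := (dataDist_le_add _ _).trans (add_le_add (hB _) (hB _))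
  have h5 : C₁ * growthWeight nZ p₁ z z₀ * (dataDist nZ z z₀ + |f z.1 - 0|) ≤
      C₁ * (⨆ z : X × Y, growthWeight nZ p z z) * ((B + B) + β * ⨆ x : X, ‖feature H x‖) :=
    mul_le_mul (mul_le_mul_of_nonneg_left h2 hC₁) (add_le_add h4 h3)
      (add_nonneg (dataDist_nonneg _ _) (abs_nonneg _))
      (mul_nonneg hC₁ ((growthWeight_nonneg p₁ z z₀).trans h2))
  have h6 := abs_sub_abs_le_abs_sub (deriv (c z) (f z.1)) (deriv (c z₀) 0)
  simp only
  linarith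

lemma lipConst_nonneg [MeasurableSpace E] {c : X × Y → ℝ → ℝ} {F : Set H} {β C₁ p Lk : ℝ}
    (hβ : 0 ≤ β) (hC₁ : 0 ≤ C₁) (hLk : 0 ≤ Lk) : 0 ≤ lipConst nZ c F β C₁ p Lk := by
  have h1 : 0 ≤ ⨆ z : X × Y, growthWeight nZ p z z :=
    Real.iSup_nonneg fun z => growthWeight_nonneg p z z
  have h2 : 0 ≤ ⨆ x : X, ‖feature H x‖ := Real.iSup_nonneg fun _ => norm_nonneg _
  have h3 : 0 ≤ ⨆ q : (X × Y) × F, |deriv (c q.1) ((q.2 : H) q.1.1)| :=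
    Real.iSup_nonneg fun _ => abs_nonneg _
  unfold lipConst
  positivity

/-- The gradient of the loss at `f ∈ F` is Lipschitz in the data point. -/
lemma norm_deriv_smul_feature_sub_le [MeasurableSpace E]
    (hnX : ∀ x y, ‖x‖ ≤ nZ (x, y)) {F : Set H} {β : ℝ}
    (hFβ : ∀ f ∈ F, ‖f‖ ≤ β) {c : X × Y → ℝ → ℝ} {C₁ p₁ p : ℝ} (hC₁ : 0 ≤ C₁) (hp : p₁ ≤ p)
    (hp2 : 2 ≤ p) (hC4 : ∀ z₁ z₂ w₁ w₂, |deriv (c z₁) w₁ - deriv (c z₂) w₂| ≤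
      C₁ * growthWeight nZ p₁ z₁ z₂ * (dataDist nZ z₁ z₂ + |w₁ - w₂|))
    (hL : BddAbove (Set.range fun z : X × Y => growthWeight nZ p z z)) {Lk : ℝ} (hLk : 0 ≤ Lk)
    (hK1 : ∀ x₁ x₂ : X, ‖feature H x₁ - feature H x₂‖ ≤ Lk * ‖(x₁ : E) - x₂‖)
    {f : H} (hf : f ∈ F) (z z' : X × Y) :
    ‖deriv (c z) (f z.1) • feature H z.1 - deriv (c z') (f z'.1) • feature H z'.1‖ ≤
      lipConst nZ c F β C₁ p Lk * dataDist nZ z z' := by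
  obtain ⟨B, hB⟩ := exists_seminorm_vec_le hp2 hL
  have hfeat := bddAbove_norm_feature hnX hLk hK1 hB z
  have hder := bddAbove_abs_deriv hFβ hC₁ hp hC4 hL hB hfeat z
  have hβ0 : 0 ≤ β := (norm_nonneg f).trans (hFβ f hf)
  set G := ⨆ z : X × Y, growthWeight nZ p z z with hG
  set κ := ⨆ x : X, ‖feature H x‖ with hκ
  set Δ := ⨆ q : (X × Y) × F, |deriv (c q.1) ((q.2 : H) q.1.1)| with hΔ
  set δ := dataDist nZ z z' with hδ
  have hδ0 : 0 ≤ δ := dataDist_nonneg z z'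
  have hx : ‖(z.1 : E) - z'.1‖ ≤ δ := norm_sub_le_dataDist hnX z z'
  have hk : ‖feature H z.1 - feature H z'.1‖ ≤ Lk * δ :=
    (hK1 _ _).trans (mul_le_mul_of_nonneg_left hx hLk)
  have hG1 : growthWeight nZ p₁ z z' ≤ G := growthWeight_le_iSup hp hL z z'
  have hG0 : 0 ≤ G := (growthWeight_nonneg _ _ _).trans hG1
  have hf1 : |f z.1 - f z'.1| ≤ β * (Lk * δ) :=
    (abs_apply_sub_apply_le f _ _).trans (mul_le_mul (hFβ f hf) hk (norm_nonneg _) hβ0)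
  have hd : |deriv (c z) (f z.1) - deriv (c z') (f z'.1)| ≤ C₁ * G * (δ + β * (Lk * δ)) :=
    (hC4 _ _ _ _).trans (mul_le_mul (mul_le_mul_of_nonneg_left hG1 hC₁)
      (add_le_add le_rfl hf1) (add_nonneg hδ0 (abs_nonneg _)) (mul_nonneg hC₁ hG0))
  have hΔ1 : |deriv (c z') (f z'.1)| ≤ Δ := le_ciSup hder (z', ⟨f, hf⟩)
  have hΔ0 : 0 ≤ Δ := (abs_nonneg _).trans hΔ1
  have hκ1 : ‖feature H z.1‖ ≤ κ := le_ciSup hfeat z.1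
  -- The first summand produces `L (1 + β L_k) sup ‖k_x‖`, the second `L_k sup |c₂'|`.
  have hsplit : deriv (c z) (f z.1) • feature H z.1 - deriv (c z') (f z'.1) • feature H z'.1 =
      (deriv (c z) (f z.1) - deriv (c z') (f z'.1)) • feature H z.1 +
        deriv (c z') (f z'.1) • (feature H z.1 - feature H z'.1) := by
    rw [sub_smul, smul_sub]; abel
  calc _ ≤ |deriv (c z) (f z.1) - deriv (c z') (f z'.1)| * ‖feature H z.1‖ +
        |deriv (c z') (f z'.1)| * ‖feature H z.1 - feature H z'.1‖ := by
        rw [hsplit, ← Real.norm_eq_abs, ← Real.norm_eq_abs, ← norm_smul, ← norm_smul]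
        exact norm_add_le _ _
    _ ≤ C₁ * G * (δ + β * (Lk * δ)) * κ + Δ * (Lk * δ) := by gcongr
    _ = lipConst nZ c F β C₁ p Lk * δ := by rw [lipConst]; ring

end Constants

end KernelRobust

end

theorem theorem7
    -- the data space `Z = X × Y`, with a norm `‖·‖` on `E = ℝⁿ` and a norm `nZ` on `E × ℝ`
    {E : Type*} [NormedAddCommGroup E] [NormedSpace ℝ E] [FiniteDimensional ℝ E]
    [MeasurableSpace E] [BorelSpace E] (X : Set E) (Y : Set ℝ)
    (nZ : Seminorm ℝ (E × ℝ)) (hnZ : ∀ v, nZ v = 0 → v = 0) (hnX : ∀ x y, ‖x‖ ≤ nZ (x, y))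
    -- the reproducing kernel Hilbert space and the feasible set
    {H : Type*} [NormedAddCommGroup H] [InnerProductSpace ℝ H] [CompleteSpace H]
    [RKHS ℝ H X ℝ] [MeasurableSpace H] [BorelSpace H]
    (F : Set H) (hFconv : Convex ℝ F) (hFclosed : IsClosed F) (hF0 : (0 : H) ∈ F)
    (β : ℝ) (hFβ : ∀ f ∈ F, ‖f‖ ≤ β)
    -- the cost, convex in its second argument
    (c : X × Y → ℝ → ℝ) (hc0 : ∀ z w, 0 ≤ c z w)
    (hC1 : ∀ z, ConvexOn ℝ Set.univ (c z))
    -- growth of the cost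
    (ψ : X × Y → ℝ) (hψ : IsGauge ψ) (hC2 : ∀ z : X × Y, ∀ f ∈ F, c z (f z.1) ≤ ψ z)
    -- Lipschitz continuity of the cost
    (Ψ : X × Y → ℝ) (hΨ0 : ∀ z, 0 ≤ Ψ z)
    (hC3 : ∀ z, ∀ w₁ ∈ Y, ∀ w₂ ∈ Y, |c z w₁ - c z w₂| ≤ Ψ z * |w₁ - w₂|)
    -- Lipschitz continuity of the derivative of the cost
    (hcdiff : ∀ z, Differentiable ℝ (c z))
    (C₁ p₁ : ℝ) (hC₁ : 0 < C₁) (hp₁ : 1 ≤ p₁)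
    (hC4 : ∀ z₁ z₂ w₁ w₂, |deriv (c z₁) w₁ - deriv (c z₂) w₂| ≤
      C₁ * growthWeight nZ p₁ z₁ z₂ * (dataDist nZ z₁ z₂ + |w₁ - w₂|))
    -- boundedness of `sup_z L_p(z, z)`
    (p : ℝ) (hp : p₁ + 1 ≤ p)
    (hL : BddAbove (Set.range fun z : X × Y => growthWeight nZ p z z))
    -- Lipschitz continuity of the feature map
    (Lk : ℝ) (hLk : 0 < Lk)
    (hK1 : ∀ x₁ x₂ : X, ‖feature H x₁ - feature H x₂‖ ≤ Lk * ‖(x₁ : E) - x₂‖)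
    -- the radius of the feasible set
    (M₃ τ : ℝ) (hM₃ : 0 < M₃) (hτ : 0 < τ) (hβ : √(M₃ / τ) < β) :
    -- the regularized empirical risk minimizer exists and is unique
    (∀ N : ℕ, 0 < N → ∀ lam : ℝ, τ ≤ lam → ∀ s : Fin N → X × Y,
      IsRegMin c F (empiricalMeasure s) lam (estimator c F lam s) ∧
      ∀ f, IsRegMin c F (empiricalMeasure s) lam f → f = estimator c F lam s) ∧
    -- it has norm less than `β`, and so lies in the interior of `F` if `F` is the ball of radius `β`
    (∀ N : ℕ, 0 < N → ∀ lam : ℝ, τ ≤ lam → ∀ s : Fin N → X × Y,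
      empiricalMeasure s ∈ momentSet ψ M₃ →
      ‖(estimator c F lam s : H)‖ < β ∧
      (F = Metric.closedBall 0 β → (estimator c F lam s : H) ∈ interior F)) ∧
    -- it is globally Lipschitz in the sample
    (∀ N : ℕ, 0 < N → ∀ lam : ℝ, τ ≤ lam → ∀ s s' : Fin N → X × Y,
      ‖(estimator c F lam s : H) - estimator c F lam s'‖ ≤
        lipConst nZ c F β C₁ p Lk / (N * lam) * ∑ i, dataDist nZ (s i) (s' i)) ∧
    -- the Kantorovich distance of the laws of the estimators
    (∀ P ∈ momentSet ψ M₃, ∀ Q ∈ momentSet ψ M₃, ∀ N : ℕ, 0 < N → ∀ lam : ℝ, τ ≤ lam →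
      kantorovich (fun f g : H => ‖f - g‖)
          (estimatorLaw c F lam N P) (estimatorLaw c F lam N Q) ≤
        ENNReal.ofReal (lipConst nZ c F β C₁ p Lk / τ) * kantorovich (dataDist nZ) P Q) := by
  have hβ0 : 0 ≤ β := (Real.sqrt_nonneg _).trans hβ.le
  have hmin : ∀ (N : ℕ) (lam : ℝ), τ ≤ lam → ∀ s : Fin N → X × Y,
      IsRegMin c F (empiricalMeasure s) lam (estimator c F lam s) := fun N lam hlam s =>
    isRegMin_estimator hc0 hC1 hFconv hFclosed ⟨0, hF0⟩ s (hτ.trans_le hlam)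
  have hC : 0 ≤ lipConst nZ c F β C₁ p Lk := lipConst_nonneg hβ0 hC₁.le hLk.le
  have hlip : ∀ N : ℕ, 0 < N → ∀ lam : ℝ, τ ≤ lam → ∀ s s' : Fin N → X × Y,
      ‖(estimator c F lam s : H) - estimator c F lam s'‖ ≤
        lipConst nZ c F β C₁ p Lk / (N * lam) * ∑ i, dataDist nZ (s i) (s' i) := by
    intro N hN lam hlam s s'
    have hlam0 : 0 < lam := hτ.trans_le hlam
    have hN0 : (0 : ℝ) < N := Nat.cast_pos.2 hN
    have h1 := (hmin N lam hlam s).norm_sub_le hC1 hcdiff hFconv (hmin N lam hlam s')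
    have h2 := Finset.sum_le_sum fun i (_ : i ∈ Finset.univ) =>
      norm_deriv_smul_feature_sub_le hnX hFβ hC₁.le (by linarith) (by linarith) hC4 hL hLk.le hK1
        (hmin N lam hlam s).1 (s i) (s' i)
    rw [← Finset.mul_sum] at h2
    have h3 := h1.trans (mul_le_mul_of_nonneg_left h2 (inv_nonneg.2 hN0.le))
    -- The stability bound carries `2 * lam`; the spare factor `2` is discarded here.
    have h4 : 0 ≤ lam * ‖(estimator c F lam s : H) - estimator c F lam s'‖ := by positivity
    rw [div_mul_eq_mul_div, le_div_iff₀ (by positivity)]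
    rw [inv_mul_eq_div, le_div_iff₀ hN0] at h3
    nlinarith
  refine ⟨fun N _ lam hlam s => ⟨hmin N lam hlam s, fun f hf =>
    hf.eq hC1 hFconv (hτ.trans_le hlam) (hmin N lam hlam s)⟩, fun N _ lam hlam s hs => ?_, hlip,
    fun P hP Q hQ N hN lam hlam => ?_⟩
  · have hlt := (hmin N lam hlam s).norm_lt hc0 hF0 hψ.2.1 hC2 hM₃.le hτ hβ hlam hs
    refine ⟨hlt, fun hF => ?_⟩
    have hball := Metric.ball_subset_interior_closedBall (mem_ball_zero_iff.2 hlt)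
    rwa [← hF] at hball
  · have := hP.1
    have := hQ.1
    have hlam0 : 0 < lam := hτ.trans_le hlam
    have hN0 : (0 : ℝ) < N := Nat.cast_pos.2 hN
    obtain ⟨B, hB⟩ := exists_seminorm_vec_le (by linarith) hL
    refine (kantorovich_map_pi_le continuous_dataDist dataDist_self
      (fun z z' => (dataDist_le_add z z').trans (add_le_add (hB z) (hB z')))
      (K := lipConst nZ c F β C₁ p Lk / (N * lam)) (by positivity)
      (hlip N hN lam hlam)).trans ?_
    gcongr
    calc (N : ℝ) * (lipConst nZ c F β C₁ p Lk / (N * lam)) = lipConst nZ c F β C₁ p Lk / lam := by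
          field_simp
      _ ≤ lipConst nZ c F β C₁ p Lk / τ := by gcongr
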